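/- **Setting.** Let $T>0$, $\alpha\ge 1$, $n\ge 0$ players with control sets $\emptyset\neq U_j\subset\mathbb R^d$ and risk-sensitivity indices $\theta_j\neq 0$, and let $b(t,x,y,u)$, $\sigma(t,x)$, running costs $f_j(t,x,m,u)$, terminal costs $h_j(x,m)$ and a probability measure $m_0$ on $\mathbb R$ be given; here $u=(u_1,\dots,u_n)$ and $m$ is a probability measure on $\mathbb R$. The drift is $$\bar b(t,x,m,u)=\Big(\int |b(t,x,y,u)|^\alpha\,m(dy)\Big)^{1/\alpha}.$$ Player $j$ uses a Markov strategy $u_j(t,x,z_j)\in U_j$ depending on the state $x$ and on the player's own accumulated running cost $z_j$; $z=(z_1,\dots,z_n)$. Let $$H_i^*(t,x,z,p,m)=\inf_{u_i\in U_i}\big[\bar b\,p+f_i\big],$$ where the other players follow their strategies $u_j(t,x,z_j)$, $j\ne i$. The functions $v_i^*(t,x,z)$, $i=1,\dots,n$, form, together with the strategies and a flow of probability measures $\mu(t,dx,dz)$ on $\mathbb R\times\mathbb R^n$ with $x$-marginal $m(t)$, a classical solution of the *dual system*: * $\mu$ solves in the sense of distributions $\mu_t+\partial_x(\bar b\mu)+\sum_j\partial_{z_j}(f_j\mu)-\tfrac12\partial_{xx}(\sigma^2\mu)=0$,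 $\mu(0)=m_0\otimes\delta_0$, with $\bar b,f_j$ evaluated at $m(t)$ and at the strategies (the integrals $\int|b|^\alpha dm(t)$ being finite); * $v^*_{i,t},v^*_{i,x},v^*_{i,xx}$ exist on $(0,T)\times\mathbb R\times\mathbb R^n$, and $\eta_i^*:=v^*_{i,z}:=\partial_{z_i}v_i^*$ exists and is continuous on $[0,T]\times\mathbb R\times\mathbb R^n$; * at each point of $(0,T)\times\mathbb R\times\mathbb R^n$ where $v^*_{i,z}\neq0$ (so that $p_i^*=v^*_{i,x}/v^*_{i,z}$ is defined), the control $u_i(t,x,z_i)$ attains the infimum $H_i^*(t,x,z,p_i^*,m(t))$, and $$0=v^*_{i,t}+v^*_{i,z}\,H_i^*\big(t,x,z,p_i^*,m\big)+\tfrac12\sigma^2v^*_{i,xx}+\int v^*_{i,z}(t,\tilde x,\tilde z)\,H^*_{i,m}\big(t,\tilde x,\tilde z,p_i^*(t,\tilde x,\tilde z),m\big)(x)\,\mu(t,d\tilde x,d\tilde z);$$ * $v_i^*(T,x,z)=e^{\theta_i(z_i+h_i(x,m(T)))}+\theta_i\int h_{i,m}(\tilde x,m(T))(x)\,e^{\theta_i(\tilde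 z_i+h_i(\tilde x,m(T)))}\,\mu(T,d\tilde x,d\tilde z)$. Here $F_m(m)(\cdot)$ denotes a Gateaux derivative of $F$ in the law: $\frac{d}{d\varepsilon}F(m+\varepsilon(\nu-m))|_{\varepsilon=0+}=\int F_m(m)\,d(\nu-m)$ for all probability measures $\nu$ with finite moment of order $\alpha$; the integrals above are assumed to converge. **Statement.** For every $i$: 1. On every open set $O\subset(0,T)\times\mathbb R\times\mathbb R^n$ on which the derivatives $\eta^*_{i,t},\eta^*_{i,x},\eta^*_{i,z}=\partial_{z_i}\eta_i^*,\eta^*_{i,xx}$ exist and are continuous, one has, at every point of $O$ where $\eta_i^*\ne0$, $$0=\eta^*_{i,t}+\bar b\,\eta^*_{i,x}+f_i\,\eta^*_{i,z}+\tfrac12\sigma^2\eta^*_{i,xx},$$ with $\bar b,f_i$ evaluated at $m(t)$ and at the strategies. 2. Suppose that either (a) $\eta_i^*$ vanishes nowhere on $[0,T]\times\mathbb R\times\mathbb R^n$ (that is, the dual equation for player $i$ makes sense everywhere), or (b) the derivatives $\eta^*_{i,t},\eta^*_{i,x},\eta^*_{i,z},\eta^*_{i,xx}$ exist and are continuous on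 $(0,T)\times\mathbb R\times\mathbb R^n$ and, for some constants, $|\bar b|+|\sigma|\le K(1+|x|)$ and $|f_i|\le K$ along the strategies on $(0,T)$, and $|\eta_i^*|\le C(1+|x|)^ke^{c|z|}$ on $[0,T]$. Then $\eta_i^*$ has constant sign on $[0,T]\times\mathbb R\times\mathbb R^n$, equal to the sign of $\theta_i$. -/

import Mathlib

open MeasureTheory Set
open scoped ContDiff

noncomputable section

namespace MFTG

/-- A control value of one player: a point of `ℝ^d`. -/
abbrev Ctrl (d : ℕ) : Type := EuclideanSpace ℝ (Fin d)

/-- A real function of `(t, x, z)`: time, state, and the vector `z = (z_1, …, z_n)` of the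
accumulated running costs. -/
abbrev Field (n : ℕ) : Type := ℝ → ℝ → (Fin n → ℝ) → ℝ

/-- The data of a risk-sensitive mean-field-type game with `n` players and one-dimensional state.
The functions of a law `m` are only ever evaluated at probability measures `m` on `ℝ`. -/
structure Game (n d : ℕ) where
  T : ℝ
  T_pos : 0 < T
  /-- the exponent of the norm in the drift -/
  α : ℝ
  one_le_α : 1 ≤ α
  /-- `b t x y u`, where `u` is the profile of the controls of all players -/
  b : ℝ → ℝ → ℝ → (Fin n → Ctrl d) → ℝ
  σ : ℝ → ℝ → ℝ
  /-- running costs `f i t x m u` -/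
  f : Fin n → ℝ → ℝ → Measure ℝ → (Fin n → Ctrl d) → ℝ
  /-- terminal costs `h i x m` -/
  h : Fin n → ℝ → Measure ℝ → ℝ
  /-- risk-sensitivity indices -/
  θ : Fin n → ℝ
  θ_ne : ∀ i, θ i ≠ 0
  /-- the control sets -/
  U : Fin n → Set (Ctrl d)
  U_nonempty : ∀ i, (U i).Nonempty
  /-- the law of the initial state -/
  m₀ : Measure ℝ
  m₀_prob : IsProbabilityMeasure m₀

/-- Markov strategies: player `j` uses the control `u j t x z_j`, a function of the time and of the
player's own working state `(x, z_j)`. -/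
abbrev Strategy (n d : ℕ) : Type := Fin n → ℝ → ℝ → ℝ → Ctrl d

variable {n d : ℕ}

/-- The `L^α`-norm drift `b̄(t,x,m,u) = (∫ |b(t,x,y,u)|^α m(dy))^{1/α}`. -/
def Game.drift (G : Game n d) (t x : ℝ) (m : Measure ℝ) (a : Fin n → Ctrl d) : ℝ :=
  (∫ y, |G.b t x y a| ^ G.α ∂m) ^ (1 / G.α)

/-- The controls of all players at `(t, x, z)`. -/
def profile (u : Strategy n d) (t x : ℝ) (z : Fin n → ℝ) : Fin n → Ctrl d :=
  fun j => u j t x (z j)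

/-- The function of `u_i` that player `i` minimizes, `b̄ p + f_i`, when player `i` uses the control
`a` and the other players follow the strategies `u` at `(t, x, z)`. -/
def Game.preHam (G : Game n d) (u : Strategy n d) (i : Fin n) (t x : ℝ) (z : Fin n → ℝ)
    (m : Measure ℝ) (p : ℝ) (a : Ctrl d) : ℝ :=
  G.drift t x m (Function.update (profile u t x z) i a) * p
    + G.f i t x m (Function.update (profile u t x z) i a)

/-- The Hamiltonian `H*_i = inf_{u_i} [b̄ p + f_i]`. -/
def Game.ham (G : Game n d) (u : Strategy n d) (i : Fin n) (t x : ℝ) (z : Fin n → ℝ)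
    (m : Measure ℝ) (p : ℝ) : ℝ :=
  sInf (G.preHam u i t x z m p '' G.U i)

/-- Partial derivatives in `t`, in `x` and in `z_i`. -/
def dt (w : Field n) : Field n := fun t x z => deriv (fun s => w s x z) t

def dx (w : Field n) : Field n := fun t x z => deriv (fun s => w t s z) x

def dz (i : Fin n) (w : Field n) : Field n :=
  fun t x z => deriv (fun s => w t x (Function.update z i s)) (z i)

/-- `D` is a Gateaux derivative of `F` at the law `m`: for every probability measure `ν` on `ℝ` with
a finite moment of order `α`, the derivative of `ε ↦ F (m + ε (ν - m))` at `ε = 0+` is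
`∫ D d(ν - m)`. (This determines `D` up to an additive constant.) -/
def IsGateauxDeriv (α : ℝ) (F : Measure ℝ → ℝ) (m : Measure ℝ) (D : ℝ → ℝ) : Prop :=
  Integrable D m ∧
  ∀ ν : Measure ℝ, IsProbabilityMeasure ν → Integrable (fun y => |y| ^ α) ν →
    Integrable D ν ∧
    HasDerivWithinAt
      (fun ε : ℝ => F (ENNReal.ofReal (1 - ε) • m + ENNReal.ofReal ε • ν))
      (∫ y, D y ∂ν - ∫ y, D y ∂m) (Ici 0) 0

/-- The generator of the process `(x, z_1, …, z_n)` under the strategies `u`, applied to `φ`: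
`b̄ φ_x + ∑_j f_j φ_{z_j} + σ²/2 φ_xx` at `w = (x, z)`. -/
def Game.generator (G : Game n d) (u : Strategy n d) (t : ℝ) (m : Measure ℝ)
    (φ : ℝ × (Fin n → ℝ) → ℝ) (w : ℝ × (Fin n → ℝ)) : ℝ :=
  G.drift t w.1 m (profile u t w.1 w.2) * deriv (fun s => φ (s, w.2)) w.1
    + ∑ j, G.f j t w.1 m (profile u t w.1 w.2)
        * deriv (fun s => φ (w.1, Function.update w.2 j s)) (w.2 j)
    + G.σ t w.1 ^ 2 / 2 * iteratedDeriv 2 (fun s => φ (s, w.2)) w.1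

/-- `μ` is a (weak) solution on `[0,T]` of the Fokker-Planck-Kolmogorov equation
`μ_t + ∂_x(b̄ μ) + ∂_z(f μ) - ½ ∂_xx(σ² μ) = 0`, `μ(0,dx,dz) = m₀(dx) δ₀(dz)`, where the drift and
the running costs are evaluated at the `x`-marginal of `μ`. -/
structure IsFPKSolution (G : Game n d) (u : Strategy n d)
    (μ : ℝ → Measure (ℝ × (Fin n → ℝ))) : Prop where
  prob : ∀ t ∈ Icc 0 G.T, IsProbabilityMeasure (μ t)
  init : μ 0 = G.m₀.prod (Measure.dirac 0)
  drift_integrable : ∀ t ∈ Icc 0 G.T, ∀ x, ∀ a : Fin n → Ctrl d, (∀ j, a j ∈ G.U j) →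
    Integrable (fun y => |G.b t x y a| ^ G.α) (μ t).fst
  gen_integrable : ∀ φ : ℝ × (Fin n → ℝ) → ℝ, ContDiff ℝ ∞ φ → HasCompactSupport φ →
    (∀ᵐ s ∂(volume.restrict (Icc 0 G.T)), Integrable (G.generator u s (μ s).fst φ) (μ s)) ∧
    IntervalIntegrable (fun s => ∫ w, G.generator u s (μ s).fst φ w ∂(μ s)) volume 0 G.T
  weak_eq : ∀ φ : ℝ × (Fin n → ℝ) → ℝ, ContDiff ℝ ∞ φ → HasCompactSupport φ →
    ∀ t ∈ Icc 0 G.T, ∫ w, φ w ∂(μ t)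
      = ∫ w, φ w ∂(μ 0) + ∫ s in (0 : ℝ)..t, ∫ w, G.generator u s (μ s).fst φ w ∂(μ s)

/-- `v = (v_1, …, v_n)` is a classical solution of the dual system, together with the strategies `u`
that minimize the Hamiltonians and the flow of laws `μ` that they generate. `Hm i t x' z'` is the
Gateaux derivative `H*_{i,m}(t, x', p, m)` in the law at `p = v_{i,x} / v_{i,z}`, and `hm i x'` is
`h_{i,m}(x', m(T))`. The Hamiltonian is evaluated at `v_{i,x} / v_{i,z}`, so that the dual equation
is imposed at the points where `v_{i,z}` does not vanish. -/
structure IsDualSolution (G : Game n d) (u : Strategy n d)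
    (μ : ℝ → Measure (ℝ × (Fin n → ℝ))) (v : Fin n → Field n)
    (Hm : Fin n → ℝ → ℝ → (Fin n → ℝ) → ℝ → ℝ) (hm : Fin n → ℝ → ℝ → ℝ) : Prop where
  mem_U : ∀ i t x ζ, u i t x ζ ∈ G.U i
  fpk : IsFPKSolution G u μ
  diff_t : ∀ i, ∀ t ∈ Ioo 0 G.T, ∀ x z, DifferentiableAt ℝ (fun s => v i s x z) t
  diff_x : ∀ i, ∀ t ∈ Ioo 0 G.T, ∀ x z, DifferentiableAt ℝ (fun s => v i t s z) x
  diff_xx : ∀ i, ∀ t ∈ Ioo 0 G.T, ∀ x z, DifferentiableAt ℝ (fun s => dx (v i) t s z) x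
  diff_z : ∀ i, ∀ t ∈ Icc 0 G.T, ∀ x z,
    DifferentiableAt ℝ (fun s => v i t x (Function.update z i s)) (z i)
  /-- `v_{i,z}` is continuous on `[0,T] × ℝ × ℝⁿ` -/
  cont_z : ∀ i, ContinuousOn (fun q : ℝ × ℝ × (Fin n → ℝ) => dz i (v i) q.1 q.2.1 q.2.2)
    (Icc 0 G.T ×ˢ univ)
  /-- `u_i` minimizes the Hamiltonian of player `i` -/
  argmin : ∀ i, ∀ t ∈ Ioo 0 G.T, ∀ x z, dz i (v i) t x z ≠ 0 →
    IsMinOn (G.preHam u i t x z (μ t).fst (dx (v i) t x z / dz i (v i) t x z)) (G.U i)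
      (u i t x (z i))
  ham_deriv : ∀ i, ∀ t ∈ Ioo 0 G.T, ∀ x z, dz i (v i) t x z ≠ 0 →
    IsGateauxDeriv G.α
      (fun m => G.ham u i t x z m (dx (v i) t x z / dz i (v i) t x z)) (μ t).fst (Hm i t x z)
  ham_integrable : ∀ i, ∀ t ∈ Ioo 0 G.T, ∀ x,
    Integrable (fun w : ℝ × (Fin n → ℝ) => dz i (v i) t w.1 w.2 * Hm i t w.1 w.2 x) (μ t)
  /-- the dual equation -/
  dual_eq : ∀ i, ∀ t ∈ Ioo 0 G.T, ∀ x z, dz i (v i) t x z ≠ 0 →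
    0 = dt (v i) t x z
      + dz i (v i) t x z
          * G.ham u i t x z (μ t).fst (dx (v i) t x z / dz i (v i) t x z)
      + 1 / 2 * G.σ t x ^ 2 * dx (dx (v i)) t x z
      + ∫ w, dz i (v i) t w.1 w.2 * Hm i t w.1 w.2 x ∂(μ t)
  term_deriv : ∀ i x, IsGateauxDeriv G.α (fun m => G.h i x m) (μ G.T).fst (hm i x)
  term_integrable : ∀ i x,
    Integrable (fun w : ℝ × (Fin n → ℝ) =>
      hm i w.1 x * Real.exp (G.θ i * (w.2 i + G.h i w.1 (μ G.T).fst))) (μ G.T)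
  /-- the terminal condition -/
  term_eq : ∀ i x z, v i G.T x z
    = Real.exp (G.θ i * (z i + G.h i x (μ G.T).fst))
      + G.θ i * ∫ w, hm i w.1 x
          * Real.exp (G.θ i * (w.2 i + G.h i w.1 (μ G.T).fst)) ∂(μ G.T)

/-- The derivatives `w_t`, `w_x`, `w_{z_i}`, `w_xx` exist and are continuous on `O`. -/
structure ParabolicRegularOn (i : Fin n) (w : Field n) (O : Set (ℝ × ℝ × (Fin n → ℝ))) :
    Prop where
  diff_t : ∀ q ∈ O, DifferentiableAt ℝ (fun s => w s q.2.1 q.2.2) q.1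
  diff_x : ∀ q ∈ O, DifferentiableAt ℝ (fun s => w q.1 s q.2.2) q.2.1
  diff_z : ∀ q ∈ O,
    DifferentiableAt ℝ (fun s => w q.1 q.2.1 (Function.update q.2.2 i s)) (q.2.2 i)
  diff_xx : ∀ q ∈ O, DifferentiableAt ℝ (fun s => dx w q.1 s q.2.2) q.2.1
  cont_t : ContinuousOn (fun q : ℝ × ℝ × (Fin n → ℝ) => dt w q.1 q.2.1 q.2.2) O
  cont_x : ContinuousOn (fun q : ℝ × ℝ × (Fin n → ℝ) => dx w q.1 q.2.1 q.2.2) O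
  cont_z : ContinuousOn (fun q : ℝ × ℝ × (Fin n → ℝ) => dz i w q.1 q.2.1 q.2.2) O
  cont_xx : ContinuousOn (fun q : ℝ × ℝ × (Fin n → ℝ) => dx (dx w) q.1 q.2.1 q.2.2) O

/-- A growth class: along the strategies `u`, the functions `b̄` and `σ` grow at most linearly in
`x` and `f_i` is bounded, and `w` grows at most polynomially in `x` and exponentially in `z`. -/
def HasModerateGrowth (G : Game n d) (u : Strategy n d) (μ : ℝ → Measure (ℝ × (Fin n → ℝ)))
    (i : Fin n) (w : Field n) : Prop :=
  (∃ K : ℝ, ∀ t ∈ Ioo 0 G.T, ∀ x z,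
      |G.drift t x (μ t).fst (profile u t x z)| ≤ K * (1 + |x|) ∧
      |G.σ t x| ≤ K * (1 + |x|) ∧
      |G.f i t x (μ t).fst (profile u t x z)| ≤ K) ∧
  (∃ C c : ℝ, ∃ k : ℕ, ∀ t ∈ Icc 0 G.T, ∀ x z,
      |w t x z| ≤ C * (1 + |x|) ^ k * Real.exp (c * ‖z‖))

end MFTG

end

open Filter Topology

namespace MFTG

/-! The linear equation is an envelope theorem. Fix `(t,x,z)` and freeze `b̄` and `f_i` at the
strategies there. When only `z_i` moves to `s`, the other controls do not change, since `u_j` sees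
only `z_j`; hence the control `u_i(t,x,z_i)` remains an admissible competitor in the Hamiltonian at
`s`. The nonlocal integral does not depend on `z`. So the frozen linear operator applied to `v_i`
is, as a function of `s`, at least (`η_i > 0`) or at most (`η_i < 0`) its value at `s = z_i`: a
local extremum (`isLocalExtr_frozen`). Its derivative vanishes there, and exchanging derivatives
gives the equation for `η_i`, with no differentiability of strategies or coefficients in `z`.

The terminal condition gives `θ_i η_i > 0` at time `T`. If `η_i` has no zeros, connectedness does
the rest. Otherwise freeze the other `z_j`, leaving a degenerate backward equation in `(t,x,s)` that
is known only off the zeros of the solution. Two barrier arguments survive this: a growing barrier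
gives `θ_i η_i ≥ 0` (`SliceRegular.nonneg`), then a shrinking paraboloid below the solution gives
strict positivity (`SliceRegular.pos`). -/

/-! ### Exchange of partial derivatives -/

/-- Exchange of a partial derivative in `t` with a partial derivative in `s`. -/
theorem hasDerivAt_deriv_swap {F G : ℝ → ℝ → ℝ} {t s₀ : ℝ}
    (hF : ∀ᶠ q : ℝ × ℝ in 𝓝 (t, s₀), HasDerivAt (fun r => F q.1 r) (G q.1 q.2) q.2)
    (hFt : ∀ᶠ s in 𝓝 s₀, DifferentiableAt ℝ (fun τ => F τ s) t)
    (hG : ∀ᶠ q : ℝ × ℝ in 𝓝 (t, s₀), DifferentiableAt ℝ (fun τ => G τ q.2) q.1)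
    (hc : ContinuousAt (fun q : ℝ × ℝ => deriv (fun τ => G τ q.2) q.1) (t, s₀)) :
    HasDerivAt (fun s => deriv (fun τ => F τ s) t) (deriv (fun τ => G τ s₀) t) s₀ := by
  rw [hasDerivAt_iff_isLittleO, Asymptotics.isLittleO_iff]
  intro ε hε
  set M := deriv (fun τ => G τ s₀) t with hM
  have hc' : ∀ᶠ q : ℝ × ℝ in 𝓝 (t, s₀), ‖deriv (fun τ => G τ q.2) q.1 - M‖ ≤ ε := by
    have := (Metric.tendsto_nhds.1 hc) ε hε
    filter_upwards [this] with q hq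
    rw [← dist_eq_norm]
    exact hq.le
  obtain ⟨δ, hδ, hbox⟩ := Metric.eventually_nhds_iff_ball.1 (hF.and (hG.and hc'))
  have hmem : ∀ τ ∈ Metric.ball t δ, ∀ s ∈ Metric.ball s₀ δ, (τ, s) ∈ Metric.ball (t, s₀) δ := by
    intro τ hτ s hs
    rw [← ball_prod_same]
    exact ⟨hτ, hs⟩
  have ht : t ∈ Metric.ball t δ := Metric.mem_ball_self hδ
  have hs₀ : s₀ ∈ Metric.ball s₀ δ := Metric.mem_ball_self hδ
  have hGest : ∀ τ ∈ Metric.ball t δ, ∀ s ∈ Metric.ball s₀ δ,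
      ‖G τ s - G t s - (τ - t) * M‖ ≤ ε * ‖τ - t‖ := by
    intro τ hτ s hs
    have := (convex_ball t δ).norm_image_sub_le_of_norm_hasDerivWithin_le (𝕜 := ℝ)
      (f := fun τ => G τ s - τ * M) (f' := fun τ => deriv (fun τ => G τ s) τ - 1 * M) (C := ε)
      (fun x hx => (((hbox _ (hmem x hx s hs)).2.1.hasDerivAt).sub
        ((hasDerivAt_id x).mul_const M)).hasDerivWithinAt)
      (fun x hx => by simpa using (hbox _ (hmem x hx s hs)).2.2) ht hτ
    calc _ = ‖G τ s - τ * M - (G t s - t * M)‖ := by congr 1; ring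
      _ ≤ _ := this
  -- Mean value inequality in `s` for the increment of `F` between times `t` and `τ`; its
  -- `s`-derivative is the increment of `G`, which `hGest` compares with `(τ - t) * M`.
  have hFest : ∀ τ ∈ Metric.ball t δ, ∀ s ∈ Metric.ball s₀ δ,
      ‖(F τ s - F τ s₀ - τ * (M * (s - s₀))) - (F t s - F t s₀ - t * (M * (s - s₀)))‖
        ≤ ε * ‖s - s₀‖ * ‖τ - t‖ := by
    intro τ hτ s hs
    have := (convex_ball s₀ δ).norm_image_sub_le_of_norm_hasDerivWithin_le (𝕜 := ℝ)
      (f := fun r => F τ r - F t r - r * ((τ - t) * M))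
      (f' := fun r => G τ r - G t r - 1 * ((τ - t) * M)) (C := ε * ‖τ - t‖)
      (fun x hx => ((((hbox _ (hmem τ hτ x hx)).1).sub (hbox _ (hmem t ht x hx)).1).sub
        ((hasDerivAt_id x).mul_const _)).hasDerivWithinAt)
      (fun x hx => by simpa using hGest τ hτ x hx) hs₀ hs
    calc _ = ‖F τ s - F t s - s * ((τ - t) * M) - (F τ s₀ - F t s₀ - s₀ * ((τ - t) * M))‖ := by
          congr 1; ring
      _ ≤ _ := this
      _ = _ := by ring
  filter_upwards [Metric.ball_mem_nhds s₀ hδ, hFt] with s hs hds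
  have hd := (hds.hasDerivAt.sub hFt.self_of_nhds.hasDerivAt).sub
    ((hasDerivAt_id' t).mul_const (M * (s - s₀)))
  -- The bound on the second difference is linear in `‖τ - t‖`, so it passes to the `τ`-derivative
  -- at `t`.
  have := hd.le_of_lip' (C := ε * ‖s - s₀‖) (by positivity) (by
    filter_upwards [Metric.ball_mem_nhds t hδ] with τ hτ
    exact hFest τ hτ s hs)
  calc _ = ‖deriv (fun τ => F τ s) t - deriv (fun τ => F τ s₀) t - 1 * (M * (s - s₀))‖ := by
        congr 1; simp; ring
    _ ≤ _ := this

/-! ### Minimum conditions and the barrier principle -/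

/-- If the second derivative were negative, the second derivative test would make `x` a local
maximum too; then `f` is locally constant and the second derivative is zero. -/
theorem deriv_deriv_nonneg_of_isLocalMin {f : ℝ → ℝ} {x : ℝ} (h : IsLocalMin f x)
    (hc : ContinuousAt f x) : 0 ≤ deriv (deriv f) x := by
  by_contra! hneg
  have hmax := isLocalMax_of_deriv_deriv_neg hneg h.deriv_eq_zero hc
  have heq : f =ᶠ[𝓝 x] fun _ => f x := by
    filter_upwards [h, hmax] with y h1 h2
    exact le_antisymm h2 h1
  have := heq.deriv.deriv_eq
  simp at this
  linarith

theorem second_order_of_forall_le {f p p' : ℝ → ℝ} {p'' x : ℝ}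
    (hf : ∀ y, DifferentiableAt ℝ f y) (hf' : DifferentiableAt ℝ (deriv f) x)
    (hp : ∀ y, HasDerivAt p (p' y) y) (hp' : HasDerivAt p' p'' x)
    (hmin : ∀ y, f x + p x ≤ f y + p y) :
    deriv f x = -p' x ∧ 0 ≤ deriv (deriv f) x + p'' := by
  have hm : IsLocalMin (fun y => f y + p y) x := Eventually.of_forall hmin
  have hd : ∀ y, HasDerivAt (fun y => f y + p y) (deriv f y + p' y) y :=
    fun y => (hf y).hasDerivAt.add (hp y)
  refine ⟨by linarith [hm.hasDerivAt_eq_zero (hd x)], ?_⟩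
  have h2 := deriv_deriv_nonneg_of_isLocalMin hm (hd x).continuousAt
  have h3 : HasDerivAt (fun y => deriv f y + p' y) _ x := hf'.hasDerivAt.add hp'
  rw [funext fun y => (hd y).deriv, h3.deriv] at h2
  exact h2

/-- One-sided because the minimum over a time interval may sit at its left endpoint, where only
later times are compared. -/
theorem hasDerivAt_nonneg_of_right_min {f : ℝ → ℝ} {f' t T : ℝ} (hf : HasDerivAt f f' t)
    (htT : t < T) (hmin : ∀ s ∈ Icc t T, f t ≤ f s) : 0 ≤ f' := by
  have h := (hasDerivWithinAt_iff_tendsto_slope' (s := Ioi t) (by simp)).1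
    (hf.hasDerivWithinAt (s := Ioi t))
  refine ge_of_tendsto h ?_
  filter_upwards [Ioo_mem_nhdsGT htT] with s hs
  rw [slope_def_field]
  exact div_nonneg (sub_nonneg.2 (hmin s ⟨hs.1.le, hs.2.le⟩)) (sub_nonneg.2 hs.1.le)

/-- A function that is nonnegative at the final time and far away, and negative somewhere, has a
negative global minimum before the final time. -/
theorem exists_neg_min {w : ℝ × ℝ × ℝ → ℝ} {t₁ T R : ℝ} (ht₁ : t₁ ≤ T)
    (hw : ContinuousOn w (Icc t₁ T ×ˢ univ)) (hT : ∀ x s, 0 ≤ w (T, x, s))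
    (hfar : ∀ t ∈ Icc t₁ T, ∀ x s, R ≤ |x| ∨ R ≤ |s| → 0 ≤ w (t, x, s))
    {x₁ s₁ : ℝ} (hneg : w (t₁, x₁, s₁) < 0) :
    ∃ t ∈ Ico t₁ T, ∃ x s, w (t, x, s) < 0 ∧
      ∀ t' ∈ Icc t₁ T, ∀ x' s', w (t, x, s) ≤ w (t', x', s') := by
  have hin : ∀ t ∈ Icc t₁ T, ∀ x s, w (t, x, s) < 0 →
      (t, x, s) ∈ Icc t₁ T ×ˢ Icc (-R) R ×ˢ Icc (-R) R := by
    intro t ht x s h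
    have := mt (hfar t ht x s) (not_le.2 h)
    push Not at this
    exact ⟨ht, abs_le.1 this.1.le, abs_le.1 this.2.le⟩
  have hcomp : IsCompact (Icc t₁ T ×ˢ Icc (-R) R ×ˢ Icc (-R) R : Set (ℝ × ℝ × ℝ)) :=
    isCompact_Icc.prod (isCompact_Icc.prod isCompact_Icc)
  have h1 := hin t₁ ⟨le_rfl, ht₁⟩ x₁ s₁ hneg
  obtain ⟨⟨t, x, s⟩, hq, hqmin⟩ := hcomp.exists_isMinOn ⟨_, h1⟩
    (hw.mono (prod_mono subset_rfl (subset_univ _)))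
  have hlt : w (t, x, s) < 0 := (hqmin h1).trans_lt hneg
  refine ⟨t, ⟨hq.1.1, lt_of_le_of_ne hq.1.2 ?_⟩, x, s, hlt, fun t' ht' x' s' => ?_⟩
  · rintro rfl
    exact absurd hlt (not_lt.2 (hT x s))
  · by_cases h : w (t', x', s') < 0
    · exact hqmin (hin t' ht' x' s' h)
    · exact hlt.le.trans (not_lt.1 h)

/-- The derivatives of `g(t, x, s)` in `t`, `s`, and twice in `x`, exist for `0 < t < T`. -/
structure SliceRegular (T : ℝ) (g : ℝ → ℝ → ℝ → ℝ) : Prop where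
  cont : ContinuousOn (fun q : ℝ × ℝ × ℝ => g q.1 q.2.1 q.2.2) (Icc 0 T ×ˢ univ)
  diff_t : ∀ t ∈ Ioo 0 T, ∀ x s, DifferentiableAt ℝ (fun τ => g τ x s) t
  diff_x : ∀ t ∈ Ioo 0 T, ∀ x s, DifferentiableAt ℝ (fun y => g t y s) x
  diff_s : ∀ t ∈ Ioo 0 T, ∀ x s, DifferentiableAt ℝ (fun r => g t x r) s
  diff_xx : ∀ t ∈ Ioo 0 T, ∀ x s, DifferentiableAt ℝ (deriv (fun y => g t y s)) x

/-- A barrier principle: `g + p` is nonnegative if it is so at the final time and far away, and if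
it cannot have a negative minimum. -/
theorem SliceRegular.add_barrier_nonneg {T R : ℝ} {g p pt px ps pxx : ℝ → ℝ → ℝ → ℝ}
    (hg : SliceRegular T g)
    (hp : Continuous (fun q : ℝ × ℝ × ℝ => p q.1 q.2.1 q.2.2))
    (hpt : ∀ t x s, HasDerivAt (fun τ => p τ x s) (pt t x s) t)
    (hpx : ∀ t x s, HasDerivAt (fun y => p t y s) (px t x s) x)
    (hps : ∀ t x s, HasDerivAt (fun r => p t x r) (ps t x s) s)
    (hpxx : ∀ t x s, HasDerivAt (fun y => px t y s) (pxx t x s) x)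
    (hT : ∀ x s, 0 ≤ g T x s + p T x s) {a : ℝ} (ha : 0 ≤ a)
    (hfar : ∀ t ∈ Ioc a T, ∀ x s, R ≤ |x| ∨ R ≤ |s| → 0 ≤ g t x s + p t x s)
    (hstrict : ∀ t ∈ Ioo a T, ∀ x s, g t x s + p t x s < 0 →
      0 ≤ deriv (fun τ => g τ x s) t + pt t x s →
      deriv (fun y => g t y s) x = -px t x s →
      deriv (fun r => g t x r) s = -ps t x s →
      0 ≤ deriv (deriv (fun y => g t y s)) x + pxx t x s → False) :
    ∀ t ∈ Ioc a T, ∀ x s, 0 ≤ g t x s + p t x s := by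
  intro t₁ ht₁ x₁ s₁
  by_contra! hneg
  -- Minimizing over `[t₁, T]` with `t₁ > a ≥ 0` keeps the minimum inside `(0, T)`, where the
  -- derivatives exist.
  obtain ⟨t, ht, x, s, hlt, hmin⟩ := exists_neg_min (R := R)
    (w := fun q => g q.1 q.2.1 q.2.2 + p q.1 q.2.1 q.2.2) ht₁.2
    ((hg.cont.mono (prod_mono (Icc_subset_Icc_left (ha.trans ht₁.1.le)) subset_rfl)).add
      hp.continuousOn) hT
    (fun t ht => hfar t ⟨ht₁.1.trans_le ht.1, ht.2⟩) hneg
  have hta : a < t := ht₁.1.trans_le ht.1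
  have ht0 : t ∈ Ioo 0 T := ⟨ha.trans_lt hta, ht.2⟩
  have hxx := second_order_of_forall_le (hg.diff_x t ht0 · s) (hg.diff_xx t ht0 x s)
    (hpx t · s) (hpxx t x s) (fun y => hmin t ⟨ht.1, ht.2.le⟩ y s)
  have hs : deriv (fun r => g t x r) s + ps t x s = 0 :=
    IsLocalMin.hasDerivAt_eq_zero (f := fun r => g t x r + p t x r)
      (Eventually.of_forall fun r => hmin t ⟨ht.1, ht.2.le⟩ x r)
      ((hg.diff_s t ht0 x s).hasDerivAt.add (hps t x s))
  refine hstrict t ⟨hta, ht.2⟩ x s hlt ?_ hxx.1 (by linarith) hxx.2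
  exact hasDerivAt_nonneg_of_right_min ((hg.diff_t t ht0 x s).hasDerivAt.add (hpt t x s)) ht.2
    (fun τ hτ => hmin τ ⟨ht.1.trans hτ.1, hτ.2⟩ x s)

/-! ### Nonnegativity under growth conditions -/

/-- Where it does not vanish, `g` solves a backward parabolic equation in `(t, x, s)`, degenerate
in `s`, whose coefficients have moderate growth. -/
def SolvesOffZeros (T K : ℝ) (g : ℝ → ℝ → ℝ → ℝ) : Prop :=
  ∀ t ∈ Ioo 0 T, ∀ x s, g t x s ≠ 0 → ∃ β φ γ : ℝ,
    |β| ≤ K * (1 + |x|) ∧ |φ| ≤ K ∧ 0 ≤ γ ∧ γ ≤ K * (1 + x ^ 2) ∧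
    deriv (fun τ => g τ x s) t + β * deriv (fun y => g t y s) x
      + φ * deriv (fun r => g t x r) s + γ * deriv (deriv (fun y => g t y s)) x = 0

theorem hasDerivAt_one_add_sq_pow (m : ℕ) (x : ℝ) :
    HasDerivAt (fun y : ℝ => (1 + y ^ 2) ^ m) (m * (1 + x ^ 2) ^ (m - 1) * (2 * x)) x := by
  have := (((hasDerivAt_id' x).fun_pow 2).const_add 1).fun_pow m
  simpa using this

theorem abs_le_one_add_sq (x : ℝ) : |x| * (1 + |x|) ≤ 2 * (1 + x ^ 2) := by
  nlinarith [sq_abs x, sq_nonneg (|x| - 1)]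

theorem abs_le_of_sq_le {a S : ℝ} (hS : 1 ≤ S) (h : a ^ 2 ≤ S) : |a| ≤ S :=
  abs_le_of_sq_le_sq (by nlinarith) (by linarith)

/-- The weak maximum principle in a class of growing functions. -/
theorem SliceRegular.nonneg {T K C c : ℝ} {k : ℕ} {g : ℝ → ℝ → ℝ → ℝ} (hg : SliceRegular T g)
    (hT0 : 0 < T) (hK : 0 ≤ K) (hC : 0 ≤ C) (hc : 0 ≤ c) (hsol : SolvesOffZeros T K g)
    (hT : ∀ x s, 0 < g T x s)
    (hgrowth : ∀ t ∈ Icc 0 T, ∀ x s, |g t x s| ≤ C * (1 + |x|) ^ k * Real.exp (c * |s|)) :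
    ∀ t ∈ Icc 0 T, ∀ x s, 0 ≤ g t x s := by
  -- The barrier is `ε e^{l(T-t)} A(x) B(s)`. The exponents `k + 1` here and `c + 1` in `B` exceed
  -- those of the growth bound, so any `ε > 0` dominates `g` far away.
  set A : ℝ → ℝ := fun x => (1 + x ^ 2) ^ (k + 1) with hA
  set A' : ℝ → ℝ := fun x => (k + 1) * (1 + x ^ 2) ^ k * (2 * x) with hA'
  set A'' : ℝ → ℝ := fun x =>
    (k + 1) * (k * (1 + x ^ 2) ^ (k - 1) * (2 * x)) * (2 * x) + (k + 1) * (1 + x ^ 2) ^ k * 2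
    with hA''
  set B : ℝ → ℝ := fun s => Real.cosh ((c + 1) * s) with hB
  set B' : ℝ → ℝ := fun s => Real.sinh ((c + 1) * s) * (c + 1) with hB'
  set a : ℝ := 4 * (k + 1) * (k + 1) with ha
  -- The first three summands absorb the drift, running-cost and diffusion terms of the barrier; the
  -- last makes it a strict supersolution.
  set l : ℝ := K * a + K * (c + 1) + K * a + 1 with hl
  have hApos : ∀ x, 0 < A x := fun x => by positivity
  have hBpos : ∀ s, 0 < B s := fun s => Real.cosh_pos _
  have hk : (0 : ℝ) ≤ k := k.cast_nonneg
  have hA1 : ∀ x, HasDerivAt A (A' x) x := fun x => by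
    simpa [hA, hA'] using hasDerivAt_one_add_sq_pow (k + 1) x
  have hA2 : ∀ x, HasDerivAt A' (A'' x) x := fun x => by
    have := ((hasDerivAt_one_add_sq_pow k x).const_mul ((k : ℝ) + 1)).fun_mul
      ((hasDerivAt_id' x).const_mul 2)
    simpa [hA', hA''] using this
  have hB1 : ∀ s, HasDerivAt B (B' s) s := fun s => by
    have := ((hasDerivAt_id s).const_mul (c + 1)).cosh
    simpa [hB, hB'] using this
  have hA'le : ∀ x, (1 + |x|) * |A' x| ≤ a * A x := fun x => by
    have hq : 0 < (1 + x ^ 2) ^ k := by positivity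
    have e : |A' x| = (k + 1) * (1 + x ^ 2) ^ k * (2 * |x|) := by
      simp only [hA', abs_mul, abs_of_pos hq, abs_of_nonneg (by positivity : (0 : ℝ) ≤ k + 1),
        abs_two]
    have h1 := mul_le_mul_of_nonneg_left (abs_le_one_add_sq x)
      (by positivity : 0 ≤ (k + 1) * (1 + x ^ 2) ^ k * 2)
    calc _ = (k + 1) * (1 + x ^ 2) ^ k * 2 * (|x| * (1 + |x|)) := by rw [e]; ring
      _ ≤ _ := h1
      _ = 4 * (k + 1) * 1 * (1 + x ^ 2) ^ (k + 1) := by ring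
      _ ≤ _ := by
        simp only [ha, hA]
        gcongr
        linarith
  have hA''le : ∀ x, (1 + x ^ 2) * A'' x ≤ a * A x := fun x => by
    have h1 : (k : ℝ) * (1 + x ^ 2) ^ (k - 1) * x ^ 2 ≤ k * (1 + x ^ 2) ^ k := by
      rcases k with _ | m
      · simp
      · rw [mul_assoc]
        refine mul_le_mul_of_nonneg_left ?_ hk
        rw [Nat.add_sub_cancel, pow_succ (1 + x ^ 2) m]
        exact mul_le_mul_of_nonneg_left (by linarith : x ^ 2 ≤ 1 + x ^ 2) (by positivity)
    have h2 : A'' x ≤ a * (1 + x ^ 2) ^ k := by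
      have h3 := mul_le_mul_of_nonneg_left h1 (by positivity : 0 ≤ 4 * ((k : ℝ) + 1))
      have h4 : 0 ≤ (k + 1) * (1 + x ^ 2) ^ k := by positivity
      calc A'' x = 4 * ((k : ℝ) + 1) * (k * (1 + x ^ 2) ^ (k - 1) * x ^ 2)
            + 2 * ((k + 1) * (1 + x ^ 2) ^ k) := by simp only [hA'']; ring
        _ ≤ 4 * ((k : ℝ) + 1) * (k * (1 + x ^ 2) ^ k) + 4 * ((k + 1) * (1 + x ^ 2) ^ k) := by
            linarith
        _ = _ := by simp only [ha]; ring
    calc _ ≤ (1 + x ^ 2) * (a * (1 + x ^ 2) ^ k) := by gcongr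
      _ = _ := by simp only [hA]; ring
  have hB'le : ∀ s, |B' s| ≤ (c + 1) * B s := fun s => by
    simp only [hB', hB, abs_mul, abs_of_nonneg (by linarith : 0 ≤ c + 1)]
    rw [mul_comm]
    gcongr
    rw [Real.abs_sinh, ← Real.cosh_abs]
    exact (Real.sinh_lt_cosh _).le
  have hBge : ∀ s, Real.exp (c * |s|) * Real.exp |s| ≤ 2 * B s := fun s => by
    simp only [hB]
    rw [← Real.cosh_abs, abs_mul, abs_of_nonneg (by linarith : 0 ≤ c + 1), ← Real.exp_add,
      Real.cosh_eq]
    have := Real.exp_pos (-((c + 1) * |s|))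
    rw [show c * |s| + |s| = (c + 1) * |s| by ring]
    linarith
  have key : ∀ ε > 0, ∀ t ∈ Ioc 0 T, ∀ x s,
      0 ≤ g t x s + ε * Real.exp (l * (T - t)) * A x * B s := by
    intro ε hε
    refine hg.add_barrier_nonneg (R := 1 + 2 * (C * 2 ^ k) / ε)
      (p := fun t x s => ε * Real.exp (l * (T - t)) * A x * B s)
      (pt := fun t x s => -l * (ε * Real.exp (l * (T - t)) * A x * B s))
      (px := fun t x s => ε * Real.exp (l * (T - t)) * A' x * B s)
      (ps := fun t x s => ε * Real.exp (l * (T - t)) * A x * B' s)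
      (pxx := fun t x s => ε * Real.exp (l * (T - t)) * A'' x * B s)
      ?_ ?_ ?_ ?_ ?_ ?_ le_rfl ?_ ?_
    · simp only [hA, hB]
      fun_prop
    · intro t x s
      have := ((((((hasDerivAt_id' t).const_sub T).const_mul l).exp).const_mul ε).mul_const
        (A x)).mul_const (B s)
      exact this.congr_deriv (by ring)
    · exact fun t x s => ((hA1 x).const_mul _).mul_const _
    · exact fun t x s => (hB1 s).const_mul _
    · exact fun t x s => ((hA2 x).const_mul _).mul_const _
    · intro x s
      have := hT x s
      have := hApos x
      have := hBpos s
      positivity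
    · intro t ht x s hfar
      have h1 := (abs_le.1 (hgrowth t ⟨ht.1.le, ht.2⟩ x s)).1
      have hE : 1 ≤ Real.exp (l * (T - t)) :=
        Real.one_le_exp (mul_nonneg (by positivity) (sub_nonneg.2 ht.2))
      have hx1 : (1 + |x|) ^ k ≤ 2 ^ k * (1 + x ^ 2) ^ k := by
        rw [← mul_pow]
        gcongr
        nlinarith [sq_abs x, sq_nonneg (|x| - 1)]
      have hR : 2 * (C * 2 ^ k) / ε ≤ (1 + x ^ 2) * Real.exp |s| := by
        have hR0 : 0 ≤ 2 * (C * 2 ^ k) / ε := by positivity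
        have e1 : 1 ≤ Real.exp |s| := Real.one_le_exp (abs_nonneg s)
        rcases hfar with h | h
        · have : |x| ≤ 1 + x ^ 2 := by nlinarith [sq_abs x, sq_nonneg (|x| - 1)]
          nlinarith
        · have := Real.add_one_le_exp |s|
          nlinarith [sq_nonneg x]
      have hR' : C * 2 ^ k ≤ ε / 2 * ((1 + x ^ 2) * Real.exp |s|) := by
        rw [div_le_iff₀ hε] at hR
        linarith
      have : C * (1 + |x|) ^ k * Real.exp (c * |s|)
          ≤ ε * Real.exp (l * (T - t)) * A x * B s := by
        calc C * (1 + |x|) ^ k * Real.exp (c * |s|)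
            ≤ C * (2 ^ k * (1 + x ^ 2) ^ k) * Real.exp (c * |s|) := by gcongr
          _ = C * 2 ^ k * ((1 + x ^ 2) ^ k * Real.exp (c * |s|)) := by ring
          _ ≤ ε / 2 * ((1 + x ^ 2) * Real.exp |s|) * ((1 + x ^ 2) ^ k * Real.exp (c * |s|)) := by
            gcongr
          _ = ε / 2 * A x * (Real.exp (c * |s|) * Real.exp |s|) := by simp only [hA]; ring
          _ ≤ ε / 2 * A x * (2 * B s) := by
            have := hApos x
            exact mul_le_mul_of_nonneg_left (hBge s) (by positivity)
          _ = ε * 1 * A x * B s := by ring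
          _ ≤ _ := by
            have := hApos x
            have := hBpos s
            gcongr
      linarith
    · intro t ht x s hneg h_t h_x h_s h_xx
      set e := ε * Real.exp (l * (T - t)) with he
      have hepos : 0 < e := by positivity
      have hAx := hApos x
      have hBs := hBpos s
      have hP : 0 < e * A x * B s := by positivity
      -- The barrier is positive, so a negative value of the sum forces `g < 0`, and the equation is
      -- available.
      obtain ⟨β, φ, γ, hβ, hφ, hγ0, hγ, heq⟩ := hsol t ht x s (by linarith)
      rw [h_x, h_s] at heq
      have i1 : β * A' x ≤ K * (a * A x) := by
        calc β * A' x ≤ |β| * |A' x| := (le_abs_self _).trans (abs_mul _ _).le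
          _ ≤ K * (1 + |x|) * |A' x| := by gcongr
          _ = K * ((1 + |x|) * |A' x|) := by ring
          _ ≤ _ := mul_le_mul_of_nonneg_left (hA'le x) hK
      have i2 : φ * B' s ≤ K * ((c + 1) * B s) := by
        calc φ * B' s ≤ |φ| * |B' s| := (le_abs_self _).trans (abs_mul _ _).le
          _ ≤ _ := by gcongr; exact hB'le s
      have i3 : γ * A'' x ≤ K * (a * A x) := by
        have : 0 ≤ A'' x := by
          have e2 : A'' x = 4 * ((k : ℝ) + 1) * (k * (1 + x ^ 2) ^ (k - 1) * x ^ 2)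
            + 2 * ((k + 1) * (1 + x ^ 2) ^ k) := by simp only [hA'']; ring
          rw [e2]
          positivity
        calc γ * A'' x ≤ K * (1 + x ^ 2) * A'' x := by gcongr
          _ = K * ((1 + x ^ 2) * A'' x) := by ring
          _ ≤ _ := mul_le_mul_of_nonneg_left (hA''le x) hK
      have j1 := mul_le_mul_of_nonneg_left i1 (by positivity : 0 ≤ e * B s)
      have j2 := mul_le_mul_of_nonneg_left i2 (by positivity : 0 ≤ e * A x)
      have j3 := mul_le_mul_of_nonneg_left i3 (by positivity : 0 ≤ e * B s)
      have j4 := mul_nonneg hγ0 h_xx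
      have : l * (e * A x * B s) = K * a * (e * A x * B s) + K * (c + 1) * (e * A x * B s)
        + K * a * (e * A x * B s) + e * A x * B s := by rw [hl]; ring
      linarith
  have hIoc : ∀ t ∈ Ioc 0 T, ∀ x s, 0 ≤ g t x s := by
    intro t ht x s
    by_contra! hneg
    have hM : 0 < Real.exp (l * (T - t)) * A x * B s :=
      mul_pos (mul_pos (Real.exp_pos _) (hApos x)) (hBpos s)
    -- With this `ε` the barrier at the point equals `-g / 2`, which is too small to compensate `g`.
    have := key (-g t x s / 2 / (Real.exp (l * (T - t)) * A x * B s))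
      (div_pos (by linarith) hM) t ht x s
    rw [mul_assoc, mul_assoc, ← mul_assoc (Real.exp _), div_mul_cancel₀ _ hM.ne'] at this
    linarith
  intro t ht x s
  rcases ht.1.eq_or_lt with rfl | h0
  · have hc0 : ContinuousWithinAt (fun t => g t x s) (Icc 0 T) 0 :=
      (hg.cont (0, x, s) ⟨ht, mem_univ _⟩).comp (f := fun t : ℝ => (t, x, s))
        (by fun_prop) (fun t ht => ⟨ht, mem_univ _⟩)
    have hc1 := hc0.mono (Ioc_subset_Icc_self)
    have : (𝓝[Ioc 0 T] (0 : ℝ)).NeBot := by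
      rw [nhdsWithin_Ioc_eq_nhdsGT hT0]; infer_instance
    exact ge_of_tendsto hc1 (eventually_mem_nhdsWithin.mono fun t ht => hIoc t ht x s)
  · exact hIoc t ⟨h0, ht.2⟩ x s

/-! ### Strict positivity -/

/-- Strict positivity, by comparison with a paraboloid whose support spreads in time. -/
theorem SliceRegular.pos {T K : ℝ} {g : ℝ → ℝ → ℝ → ℝ} (hg : SliceRegular T g)
    (hK : 0 ≤ K) (hsol : SolvesOffZeros T K g)
    (hT : ∀ x s, 0 < g T x s) (hnn : ∀ t ∈ Icc 0 T, ∀ x s, 0 ≤ g t x s) :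
    ∀ t ∈ Icc 0 T, ∀ x s, 0 < g t x s := by
  intro t₀ ht₀ x₀ s₀
  rcases ht₀.2.eq_or_lt with rfl | hlt
  · exact hT x₀ s₀
  -- Where `S t - (x - x₀)² - (s - s₀)²` is positive, both displacements are at most `S t`; `l * S
  -- t` then exceeds the drift, running-cost and diffusion terms by `S t`.
  set l : ℝ := 2 * K * (1 + |x₀|) + 2 * K + 2 * K + 2 * K * (1 + 2 * x₀ ^ 2) + 4 * K + 1 with hl
  have hl0 : 0 < l := by positivity
  set S : ℝ → ℝ := fun t => Real.exp (l * (t - t₀)) with hS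
  have hSpos : ∀ t, 0 < S t := fun t => Real.exp_pos _
  have hS1 : ∀ t, t₀ ≤ t → 1 ≤ S t := fun t ht =>
    Real.one_le_exp (mul_nonneg hl0.le (sub_nonneg.2 ht))
  have hSmono : ∀ t ≤ T, S t ≤ S T := fun t ht => by
    simp only [hS]
    gcongr
  set R₀ := S T + 1 with hR₀
  have hbox : IsCompact (Icc (x₀ - R₀) (x₀ + R₀) ×ˢ Icc (s₀ - R₀) (s₀ + R₀) : Set (ℝ × ℝ)) :=
    isCompact_Icc.prod isCompact_Icc
  have hR₀pos : 0 < R₀ := by have := hSpos T; linarith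
  obtain ⟨⟨xm, sm⟩, -, hm⟩ := hbox.exists_isMinOn (f := fun q : ℝ × ℝ => g T q.1 q.2)
    ⟨(x₀, s₀), by constructor <;> constructor <;> simp <;> linarith⟩
    (hg.cont.comp (f := fun q : ℝ × ℝ => (T, q.1, q.2)) (by fun_prop)
      (fun q _ => ⟨⟨ht₀.1.trans ht₀.2, le_rfl⟩, mem_univ _⟩))
  -- The minimum of `g T` over the box divided by the height of the paraboloid at time `T`: the
  -- scaled paraboloid starts below `g`.
  set ε := g T xm sm / S T with hε
  have hεpos : 0 < ε := div_pos (hT xm sm) (hSpos T)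
  have hyneg : ∀ t ≤ T, ∀ x s, R₀ ≤ |x - x₀| ∨ R₀ ≤ |s - s₀| →
      S t - (x - x₀) ^ 2 - (s - s₀) ^ 2 ≤ 0 := by
    intro t ht x s h
    have h1 := hSmono t ht
    have h2 := hSpos T
    rcases h with h | h
    · nlinarith [sq_abs (x - x₀), sq_nonneg (s - s₀)]
    · nlinarith [sq_abs (s - s₀), sq_nonneg (x - x₀)]
  have hIoc : ∀ t ∈ Ioc t₀ T, ∀ x s,
      0 ≤ g t x s + -ε * (S t - (x - x₀) ^ 2 - (s - s₀) ^ 2) := by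
    refine hg.add_barrier_nonneg (R := R₀ + |x₀| + |s₀|)
      (p := fun t x s => -ε * (S t - (x - x₀) ^ 2 - (s - s₀) ^ 2))
      (pt := fun t x s => -ε * (l * S t))
      (px := fun t x s => -ε * -(2 * (x - x₀)))
      (ps := fun t x s => -ε * -(2 * (s - s₀)))
      (pxx := fun t x s => -ε * -(2 * 1))
      ?_ ?_ ?_ ?_ ?_ ?_ ht₀.1 ?_ ?_
    · simp only [hS]
      fun_prop
    · intro t x s
      have := ((((((hasDerivAt_id' t).sub_const t₀).const_mul l).exp).sub_const
        ((x - x₀) ^ 2)).sub_const ((s - s₀) ^ 2)).const_mul (-ε)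
      exact this.congr_deriv (by simp only [hS]; ring)
    · intro t x s
      have := ((((((hasDerivAt_id' x).sub_const x₀).fun_pow 2).const_sub (S t)).sub_const
        ((s - s₀) ^ 2))).const_mul (-ε)
      exact this.congr_deriv (by simp)
    · intro t x s
      have := (((((hasDerivAt_id' s).sub_const s₀).fun_pow 2).const_sub
        (S t - (x - x₀) ^ 2))).const_mul (-ε)
      exact this.congr_deriv (by simp)
    · intro t x s
      exact ((((hasDerivAt_id x).sub_const x₀).const_mul 2).neg).const_mul (-ε)
    · intro x s
      by_cases h : R₀ ≤ |x - x₀| ∨ R₀ ≤ |s - s₀|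
      · have := mul_nonneg hεpos.le (neg_nonneg.2 (hyneg T le_rfl x s h))
        linarith [hT x s]
      · push Not at h
        have h1 := abs_le.1 h.1.le
        have h2 := abs_le.1 h.2.le
        have h3 : g T xm sm ≤ g T x s :=
          hm (⟨⟨by linarith [h1.1], by linarith [h1.2]⟩, ⟨by linarith [h2.1], by linarith [h2.2]⟩⟩ :
            (x, s) ∈ Icc (x₀ - R₀) (x₀ + R₀) ×ˢ Icc (s₀ - R₀) (s₀ + R₀))
        have h4 : ε * S T = g T xm sm := div_mul_cancel₀ _ (hSpos T).ne'
        linarith [mul_nonneg hεpos.le (sq_nonneg (x - x₀)),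
          mul_nonneg hεpos.le (sq_nonneg (s - s₀))]
    · intro t ht x s hfar
      have : R₀ ≤ |x - x₀| ∨ R₀ ≤ |s - s₀| := by
        refine hfar.imp (fun h => ?_) (fun h => ?_)
        · linarith [abs_sub_abs_le_abs_sub x x₀, abs_nonneg s₀]
        · linarith [abs_sub_abs_le_abs_sub s s₀, abs_nonneg x₀]
      have := mul_nonneg hεpos.le (neg_nonneg.2 (hyneg t ht.2 x s this))
      linarith [hnn t ⟨ht₀.1.trans ht.1.le, ht.2⟩ x s]
    · intro t ht x s hneg h_t h_x h_s h_xx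
      have ht0 : t ∈ Ioo 0 T := ⟨ht₀.1.trans_lt ht.1, ht.2⟩
      have hSt := hSpos t
      -- At a zero the equation is unavailable, but `g ≥ 0` makes it a minimum in time, so `g_t =
      -- 0`, against the strict growth of the paraboloid in `t`.
      by_cases h0 : g t x s = 0
      · have hd : deriv (fun τ => g τ x s) t = 0 := by
          refine IsLocalMin.deriv_eq_zero (f := fun τ => g τ x s) ?_
          filter_upwards [Ioo_mem_nhds ht0.1 ht0.2] with τ hτ
          rw [h0]
          exact hnn τ ⟨hτ.1.le, hτ.2.le⟩ x s
        have : 0 < ε * (l * S t) := by positivity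
        linarith
      · obtain ⟨β, φ, γ, hβ, hφ, hγ0, hγ, heq⟩ := hsol t ht0 x s h0
        have hy : 0 < S t - (x - x₀) ^ 2 - (s - s₀) ^ 2 := by
          have := hnn t ⟨ht0.1.le, ht0.2.le⟩ x s
          by_contra! hy
          linarith [mul_nonneg hεpos.le (neg_nonneg.2 hy)]
        rw [h_x, h_s] at heq
        have hSt1 := hS1 t ht.1.le
        have hD : (x - x₀) ^ 2 ≤ S t := by linarith [sq_nonneg (s - s₀)]
        have hE : (s - s₀) ^ 2 ≤ S t := by linarith [sq_nonneg (x - x₀)]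
        have hDa : |x - x₀| ≤ S t := abs_le_of_sq_le hSt1 hD
        have hEa : |s - s₀| ≤ S t := abs_le_of_sq_le hSt1 hE
        have i1 : β * (x - x₀) ≤ K * (1 + |x₀|) * S t + K * S t := by
          calc β * (x - x₀) ≤ |β| * |x - x₀| := (le_abs_self _).trans (abs_mul _ _).le
            _ ≤ K * (1 + |x|) * |x - x₀| := by gcongr
            _ ≤ K * (1 + |x₀| + |x - x₀|) * |x - x₀| := by
              refine mul_le_mul_of_nonneg_right (mul_le_mul_of_nonneg_left ?_ hK) (abs_nonneg _)
              linarith [abs_sub_abs_le_abs_sub x x₀]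
            _ = K * (1 + |x₀|) * |x - x₀| + K * (x - x₀) ^ 2 := by rw [← sq_abs (x - x₀)]; ring
            _ ≤ _ := by gcongr
        have i2 : φ * (s - s₀) ≤ K * S t := by
          calc φ * (s - s₀) ≤ |φ| * |s - s₀| := (le_abs_self _).trans (abs_mul _ _).le
            _ ≤ _ := by gcongr
        have i3 : γ ≤ K * (1 + 2 * x₀ ^ 2) * S t + 2 * K * S t := by
          calc γ ≤ K * (1 + x ^ 2) := hγ
            _ ≤ K * ((1 + 2 * x₀ ^ 2) + 2 * (x - x₀) ^ 2) := by
              refine mul_le_mul_of_nonneg_left ?_ hK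
              nlinarith [sq_nonneg (x - x₀ - x₀)]
            _ = K * (1 + 2 * x₀ ^ 2) * 1 + 2 * K * (x - x₀) ^ 2 := by ring
            _ ≤ _ := by gcongr
        have j4 := mul_nonneg hγ0 h_xx
        have hfin : 0 < l * S t - 2 * (β * (x - x₀)) - 2 * (φ * (s - s₀)) - 2 * γ := by
          have : l * S t = 2 * (K * (1 + |x₀|) * S t + K * S t) + 2 * (K * S t)
            + 2 * (K * (1 + 2 * x₀ ^ 2) * S t + 2 * K * S t) + S t := by rw [hl]; ring
          linarith
        have := mul_pos hεpos hfin
        linarith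
  have hc0 : ContinuousWithinAt (fun t => g t x₀ s₀) (Icc 0 T) t₀ :=
    (hg.cont (t₀, x₀, s₀) ⟨ht₀, mem_univ _⟩).comp (f := fun t : ℝ => (t, x₀, s₀))
      (by fun_prop) (fun t ht => ⟨ht, mem_univ _⟩)
  have hc1 := hc0.mono (Ioc_subset_Icc_self.trans (Icc_subset_Icc_left ht₀.1))
  have : (𝓝[Ioc t₀ T] t₀).NeBot := by
    rw [nhdsWithin_Ioc_eq_nhdsGT hlt]; infer_instance
  refine hεpos.trans_le (ge_of_tendsto hc1 (eventually_mem_nhdsWithin.mono fun t ht => ?_))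
  have h1 := hIoc t ht x₀ s₀
  have h2 := mul_le_mul_of_nonneg_left (hS1 t ht.1.le) hεpos.le
  simp only [sub_self] at h1
  linarith

end MFTG

namespace MFTG

/-! ### The linear equation by an envelope argument -/

/-- Differentiation in `s` of the extremality of `V_t + β V_x + φ E + γ V_xx`, where `E = V_s`. -/
theorem linear_equation_of_isLocalExtr {V E : ℝ → ℝ → ℝ → ℝ} {O : Set (ℝ × ℝ × ℝ)} (hO : IsOpen O)
    (hV : ∀ q ∈ O, HasDerivAt (fun r => V q.1 q.2.1 r) (E q.1 q.2.1 q.2.2) q.2.2)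
    (hVt : ∀ q ∈ O, DifferentiableAt ℝ (fun τ => V τ q.2.1 q.2.2) q.1)
    (hVx : ∀ q ∈ O, DifferentiableAt ℝ (fun y => V q.1 y q.2.2) q.2.1)
    (hVxx : ∀ q ∈ O, DifferentiableAt ℝ (deriv (fun y => V q.1 y q.2.2)) q.2.1)
    (hEt : ∀ q ∈ O, DifferentiableAt ℝ (fun τ => E τ q.2.1 q.2.2) q.1)
    (hEx : ∀ q ∈ O, DifferentiableAt ℝ (fun y => E q.1 y q.2.2) q.2.1)
    (hExx : ∀ q ∈ O, DifferentiableAt ℝ (deriv (fun y => E q.1 y q.2.2)) q.2.1)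
    (hct : ContinuousOn (fun q : ℝ × ℝ × ℝ => deriv (fun τ => E τ q.2.1 q.2.2) q.1) O)
    (hcx : ContinuousOn (fun q : ℝ × ℝ × ℝ => deriv (fun y => E q.1 y q.2.2) q.2.1) O)
    (hcxx : ContinuousOn
      (fun q : ℝ × ℝ × ℝ => deriv (deriv (fun y => E q.1 y q.2.2)) q.2.1) O)
    {t x s₀ β φ γ : ℝ} (hq : (t, x, s₀) ∈ O) (hEs : DifferentiableAt ℝ (fun r => E t x r) s₀)
    (hext : IsLocalExtr (fun s => deriv (fun τ => V τ x s) t + β * deriv (fun y => V t y s) x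
      + φ * E t x s + γ * deriv (deriv (fun y => V t y s)) x) s₀) :
    0 = deriv (fun τ => E τ x s₀) t + β * deriv (fun y => E t y s₀) x
      + φ * deriv (fun r => E t x r) s₀ + γ * deriv (deriv (fun y => E t y s₀)) x := by
  have nh_t : ∀ t x s, (t, x, s) ∈ O → ∀ᶠ q : ℝ × ℝ in 𝓝 (t, s), (q.1, x, q.2) ∈ O :=
    fun t x s h => (by fun_prop : Continuous fun q : ℝ × ℝ => (q.1, x, q.2)).continuousAt
      (hO.mem_nhds h)
  have nh_x : ∀ t x s, (t, x, s) ∈ O → ∀ᶠ q : ℝ × ℝ in 𝓝 (x, s), (t, q.1, q.2) ∈ O :=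
    fun t x s h => (by fun_prop : Continuous fun q : ℝ × ℝ => (t, q.1, q.2)).continuousAt
      (hO.mem_nhds h)
  have nh_s : ∀ t x s, (t, x, s) ∈ O → ∀ᶠ r in 𝓝 s, (t, x, r) ∈ O :=
    fun t x s h => (by fun_prop : Continuous fun r : ℝ => (t, x, r)).continuousAt
      (hO.mem_nhds h)
  have d_t : HasDerivAt (fun s => deriv (fun τ => V τ x s) t) (deriv (fun τ => E τ x s₀) t) s₀ := by
    refine hasDerivAt_deriv_swap (F := fun τ s => V τ x s) (G := fun τ s => E τ x s) ?_ ?_ ?_ ?_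
    · exact (nh_t t x s₀ hq).mono fun q h => hV _ h
    · exact (nh_s t x s₀ hq).mono fun s h => hVt _ h
    · exact (nh_t t x s₀ hq).mono fun q h => hEt _ h
    · exact ContinuousAt.comp (f := fun q : ℝ × ℝ => (q.1, x, q.2)) (x := (t, s₀))
        (hct.continuousAt (hO.mem_nhds hq)) (by fun_prop)
  have d_x : ∀ y s, (t, y, s) ∈ O → HasDerivAt (fun s => deriv (fun y => V t y s) y)
      (deriv (fun y => E t y s) y) s := by
    intro y s h
    refine hasDerivAt_deriv_swap (F := fun y s => V t y s) (G := fun y s => E t y s) ?_ ?_ ?_ ?_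
    · exact (nh_x t y s h).mono fun q h => hV _ h
    · exact (nh_s t y s h).mono fun s h => hVx _ h
    · exact (nh_x t y s h).mono fun q h => hEx _ h
    · exact ContinuousAt.comp (f := fun q : ℝ × ℝ => (t, q.1, q.2)) (x := (y, s))
        (hcx.continuousAt (hO.mem_nhds h)) (by fun_prop)
  -- A second exchange, applied to the pair `V_x`, `E_x`; this is why `d_x` is proved at all nearby
  -- points.
  have d_xx : HasDerivAt (fun s => deriv (deriv (fun y => V t y s)) x)
      (deriv (deriv (fun y => E t y s₀)) x) s₀ := by
    refine hasDerivAt_deriv_swap (F := fun y s => deriv (fun y => V t y s) y)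
      (G := fun y s => deriv (fun y => E t y s) y) ?_ ?_ ?_ ?_
    · exact (nh_x t x s₀ hq).mono fun q h => d_x _ _ h
    · exact (nh_s t x s₀ hq).mono fun s h => hVxx _ h
    · exact (nh_x t x s₀ hq).mono fun q h => hExx _ h
    · exact ContinuousAt.comp (f := fun q : ℝ × ℝ => (t, q.1, q.2)) (x := (x, s₀))
        (hcxx.continuousAt (hO.mem_nhds hq)) (by fun_prop)
  exact (hext.hasDerivAt_eq_zero (((d_t.add ((d_x x s₀ hq).const_mul β)).add
    (hEs.hasDerivAt.const_mul φ)).add (d_xx.const_mul γ))).symm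

variable {n d : ℕ}

theorem dz_update (i : Fin n) (w : Field n) (t x : ℝ) (z : Fin n → ℝ) (s : ℝ) :
    dz i w t x (Function.update z i s) = deriv (fun r => w t x (Function.update z i r)) s := by
  simp [dz]

theorem update_profile_update (u : Strategy n d) (i : Fin n) (t x : ℝ) (z : Fin n → ℝ) (s : ℝ)
    (a : Ctrl d) :
    Function.update (profile u t x (Function.update z i s)) i a
      = Function.update (profile u t x z) i a := by
  ext1 j
  by_cases h : j = i
  · subst h; simp
  · simp [profile, h]

/-- Keeping player `i`'s control from `z` while `z_i` moves to `s` leaves the whole control profile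
unchanged: the cost of the frozen competitor. -/
theorem preHam_update (G : Game n d) (u : Strategy n d) (i : Fin n) (t x : ℝ) (z : Fin n → ℝ)
    (s : ℝ) (m : Measure ℝ) (p : ℝ) :
    G.preHam u i t x (Function.update z i s) m p (u i t x (z i))
      = G.drift t x m (profile u t x z) * p + G.f i t x m (profile u t x z) := by
  have : Function.update (profile u t x z) i (u i t x (z i)) = profile u t x z :=
    Function.update_eq_self i (profile u t x z)
  rw [Game.preHam, update_profile_update, this]

theorem continuous_slice (i : Fin n) (z : Fin n → ℝ) :
    Continuous fun q : ℝ × ℝ × ℝ => (q.1, q.2.1, Function.update z i q.2.2) :=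
  continuous_fst.prodMk (continuous_snd.fst.prodMk
    (continuous_const.update i continuous_snd.snd))

namespace IsDualSolution

variable {G : Game n d} {u : Strategy n d} {μ : ℝ → Measure (ℝ × (Fin n → ℝ))} {v : Fin n → Field n}
  {Hm : Fin n → ℝ → ℝ → (Fin n → ℝ) → ℝ → ℝ} {hm : Fin n → ℝ → ℝ → ℝ}

/-- The strategies attain the infima that define the Hamiltonians. -/
theorem isLeast_ham (hv : IsDualSolution G u μ v Hm hm) (i : Fin n) {t : ℝ} (ht : t ∈ Ioo 0 G.T)
    (x : ℝ) (z : Fin n → ℝ) (h0 : dz i (v i) t x z ≠ 0) :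
    IsLeast (G.preHam u i t x z (μ t).fst (dx (v i) t x z / dz i (v i) t x z) '' G.U i)
      (G.preHam u i t x z (μ t).fst (dx (v i) t x z / dz i (v i) t x z) (u i t x (z i))) :=
  ⟨mem_image_of_mem _ (hv.mem_U i t x (z i)),
    forall_mem_image.2 fun _ ha => hv.argmin i t ht x z h0 ha⟩

/-- The frozen operator equals `-I` at `z_i`, by optimality of the strategy, and nearby differs from
`-I` by `η_i` times the competitor's nonnegative excess over the Hamiltonian. By continuity `η_i`
keeps its sign near `z_i`, which decides between minimum and maximum. -/
theorem isLocalExtr_frozen (hv : IsDualSolution G u μ v Hm hm) (i : Fin n) {t : ℝ}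
    (ht : t ∈ Ioo 0 G.T) (x : ℝ) (z : Fin n → ℝ) (h0 : dz i (v i) t x z ≠ 0) :
    IsLocalExtr (fun s => dt (v i) t x (Function.update z i s)
      + G.drift t x (μ t).fst (profile u t x z) * dx (v i) t x (Function.update z i s)
      + G.f i t x (μ t).fst (profile u t x z) * dz i (v i) t x (Function.update z i s)
      + 1 / 2 * G.σ t x ^ 2 * dx (dx (v i)) t x (Function.update z i s)) (z i) := by
  set I := ∫ w, dz i (v i) t w.1 w.2 * Hm i t w.1 w.2 x ∂(μ t) with hI
  have hcont : ContinuousAt (fun s => dz i (v i) t x (Function.update z i s)) (z i) :=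
    ContinuousOn.continuousAt
      ((hv.cont_z i).comp (f := fun s : ℝ => (t, x, Function.update z i s)) (s := univ)
        ((continuous_slice i z).comp (by fun_prop : Continuous fun s : ℝ => (t, x, s))).continuousOn
        (fun s _ => ⟨Ioo_subset_Icc_self ht, mem_univ _⟩)) univ_mem
  have hbase : dt (v i) t x z + G.drift t x (μ t).fst (profile u t x z) * dx (v i) t x z
      + G.f i t x (μ t).fst (profile u t x z) * dz i (v i) t x z
      + 1 / 2 * G.σ t x ^ 2 * dx (dx (v i)) t x z = -I := by
    have h1 := hv.dual_eq i t ht x z h0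
    rw [Game.ham, (hv.isLeast_ham i ht x z h0).csInf_eq] at h1
    have h2 := preHam_update G u i t x z (z i) (μ t).fst (dx (v i) t x z / dz i (v i) t x z)
    rw [Function.update_eq_self] at h2
    rw [h2] at h1
    have h3 : dz i (v i) t x z * (dx (v i) t x z / dz i (v i) t x z) = dx (v i) t x z :=
      mul_div_cancel₀ _ h0
    linear_combination -h1 - G.drift t x (μ t).fst (profile u t x z) * h3
  have hle : ∀ s, dz i (v i) t x (Function.update z i s) ≠ 0 → ∃ H,
      H ≤ G.drift t x (μ t).fst (profile u t x z) *
          (dx (v i) t x (Function.update z i s) / dz i (v i) t x (Function.update z i s))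
        + G.f i t x (μ t).fst (profile u t x z) ∧
      0 = dt (v i) t x (Function.update z i s) + dz i (v i) t x (Function.update z i s) * H
        + 1 / 2 * G.σ t x ^ 2 * dx (dx (v i)) t x (Function.update z i s) + I := by
    intro s hs
    refine ⟨_, ?_, hv.dual_eq i t ht x _ hs⟩
    rw [← preHam_update G u i t x z s]
    have hl := hv.isLeast_ham i ht x _ hs
    rw [Game.ham, hl.csInf_eq]
    exact hl.2 (mem_image_of_mem _ (hv.mem_U i t x (z i)))
  have hmul : ∀ s, dz i (v i) t x (Function.update z i s) ≠ 0 →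
      dz i (v i) t x (Function.update z i s) *
        (dx (v i) t x (Function.update z i s) / dz i (v i) t x (Function.update z i s))
        = dx (v i) t x (Function.update z i s) := fun s hs => mul_div_cancel₀ _ hs
  have h0' : dz i (v i) t x (Function.update z i (z i)) ≠ 0 := by
    rwa [Function.update_eq_self]
  rcases lt_or_gt_of_ne h0' with hneg | hpos
  · right
    filter_upwards [hcont.eventually (gt_mem_nhds hneg)] with s hs
    obtain ⟨H, hH, heq⟩ := hle s hs.ne
    have h1 := mul_le_mul_of_nonpos_left hH hs.le
    have h2 := congrArg (G.drift t x (μ t).fst (profile u t x z) * ·) (hmul s hs.ne)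
    simp only [Function.update_eq_self] at *
    linarith
  · left
    filter_upwards [hcont.eventually (lt_mem_nhds hpos)] with s hs
    obtain ⟨H, hH, heq⟩ := hle s hs.ne'
    have h1 := mul_le_mul_of_nonneg_left hH hs.le
    have h2 := congrArg (G.drift t x (μ t).fst (profile u t x z) * ·) (hmul s hs.ne')
    simp only [Function.update_eq_self] at *
    linarith

/-- The linear equation for `η_i = v_{i,z}`. -/
theorem linear_equation (hv : IsDualSolution G u μ v Hm hm) (i : Fin n)
    {O : Set (ℝ × ℝ × (Fin n → ℝ))} (hO : IsOpen O) (hOT : O ⊆ Ioo 0 G.T ×ˢ univ)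
    (hreg : ParabolicRegularOn i (dz i (v i)) O) {t x : ℝ} {z : Fin n → ℝ}
    (hq : (t, x, z) ∈ O) (h0 : dz i (v i) t x z ≠ 0) :
    0 = dt (dz i (v i)) t x z
      + G.drift t x (μ t).fst (profile u t x z) * dx (dz i (v i)) t x z
      + G.f i t x (μ t).fst (profile u t x z) * dz i (dz i (v i)) t x z
      + 1 / 2 * G.σ t x ^ 2 * dx (dx (dz i (v i))) t x z := by
  have hc := continuous_slice i z
  have hq' : (t, x, Function.update z i (z i)) ∈ O := by rwa [Function.update_eq_self]
  have hT : ∀ q : ℝ × ℝ × ℝ, (q.1, q.2.1, Function.update z i q.2.2) ∈ O → q.1 ∈ Ioo 0 G.T :=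
    fun q h => (hOT h).1
  have := linear_equation_of_isLocalExtr (V := fun t x s => v i t x (Function.update z i s))
    (E := fun t x s => dz i (v i) t x (Function.update z i s)) (hO.preimage hc)
    (fun q h => by
      have h1 := hv.diff_z i q.1 (Ioo_subset_Icc_self (hT q h)) q.2.1 (Function.update z i q.2.2)
      simp only [Function.update_idem, Function.update_self] at h1
      simpa only [dz_update] using h1.hasDerivAt)
    (fun q h => hv.diff_t i q.1 (hT q h) _ _) (fun q h => hv.diff_x i q.1 (hT q h) _ _)
    (fun q h => hv.diff_xx i q.1 (hT q h) _ _) (fun q h => hreg.diff_t _ h)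
    (fun q h => hreg.diff_x _ h) (fun q h => hreg.diff_xx _ h)
    (hreg.cont_t.comp hc.continuousOn fun _ h => h) (hreg.cont_x.comp hc.continuousOn fun _ h => h)
    (hreg.cont_xx.comp hc.continuousOn fun _ h => h) hq' (hreg.diff_z _ hq)
    (hv.isLocalExtr_frozen i (hOT hq).1 x z h0)
  simp only [Function.update_eq_self] at this
  exact this

/-! ### The sign of `η_i` -/

theorem dz_terminal (hv : IsDualSolution G u μ v Hm hm) (i : Fin n) (x : ℝ) (z : Fin n → ℝ) :
    dz i (v i) G.T x z
      = G.θ i * Real.exp (G.θ i * (z i + G.h i x (μ G.T).fst)) := by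
  simp only [dz, hv.term_eq, Function.update_self]
  have := ((((hasDerivAt_id' (z i)).add_const (G.h i x (μ G.T).fst)).const_mul
    (G.θ i)).exp).add_const (G.θ i * ∫ w, hm i w.1 x
          * Real.exp (G.θ i * (w.2 i + G.h i w.1 (μ G.T).fst)) ∂(μ G.T))
  rw [this.deriv]
  ring

theorem mul_dz_terminal_pos (hv : IsDualSolution G u μ v Hm hm) (i : Fin n) (x : ℝ)
    (z : Fin n → ℝ) : 0 < G.θ i * dz i (v i) G.T x z := by
  rw [hv.dz_terminal, ← mul_assoc]
  exact mul_pos (mul_self_pos.2 (G.θ_ne i)) (Real.exp_pos _)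

/-- A continuous function without zeros on a connected set keeps the sign it has at time `T`. -/
theorem mul_dz_pos_of_ne_zero (hv : IsDualSolution G u μ v Hm hm) (i : Fin n)
    (hne : ∀ t ∈ Icc 0 G.T, ∀ x z, dz i (v i) t x z ≠ 0) :
    ∀ t ∈ Icc 0 G.T, ∀ x z, 0 < G.θ i * dz i (v i) t x z := by
  intro t ht x z
  by_contra! h
  have hpre : IsPreconnected (Icc 0 G.T ×ˢ univ : Set (ℝ × ℝ × (Fin n → ℝ))) :=
    isPreconnected_Icc.prod isPreconnected_univ
  obtain ⟨q, hq, hq0⟩ := hpre.intermediate_value (a := (t, x, z)) (b := (G.T, x, z))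
    ⟨ht, mem_univ _⟩ ⟨⟨G.T_pos.le, le_rfl⟩, mem_univ _⟩
    (f := fun q => G.θ i * dz i (v i) q.1 q.2.1 q.2.2) (continuousOn_const.mul (hv.cont_z i))
    ⟨h, (hv.mul_dz_terminal_pos i x z).le⟩
  exact mul_ne_zero (G.θ_ne i) (hne q.1 hq.1 q.2.1 q.2.2) hq0

theorem mul_dz_pos_of_moderateGrowth (hv : IsDualSolution G u μ v Hm hm) (i : Fin n)
    (hreg : ParabolicRegularOn i (dz i (v i)) (Ioo 0 G.T ×ˢ univ))
    (hgr : HasModerateGrowth G u μ i (dz i (v i))) :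
    ∀ t ∈ Icc 0 G.T, ∀ x z, 0 < G.θ i * dz i (v i) t x z := by
  intro t ht x z
  obtain ⟨⟨K, hK⟩, C, c, k, hC⟩ := hgr
  have hK0 : 0 ≤ K :=
    (abs_nonneg _).trans (hK (G.T / 2) ⟨half_pos G.T_pos, half_lt_self G.T_pos⟩ 0 0).2.2
  -- The linear equation has no derivative in `z_j`, `j ≠ i`, so these coordinates are mere
  -- parameters; the factor `θ_i` makes the terminal value positive.
  set g : ℝ → ℝ → ℝ → ℝ := fun t x s => G.θ i * dz i (v i) t x (Function.update z i s) with hg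
  have hmem : ∀ t ∈ Ioo 0 G.T, ∀ x z, ((t, x, z) : ℝ × ℝ × (Fin n → ℝ)) ∈
      (Ioo 0 G.T ×ˢ univ : Set (ℝ × ℝ × (Fin n → ℝ))) := fun t ht x z => ⟨ht, mem_univ _⟩
  have hderivx : ∀ t s, deriv (fun y => g t y s)
      = fun x => G.θ i * dx (dz i (v i)) t x (Function.update z i s) := fun t s => by
    ext x
    simp only [hg, deriv_const_mul_field]
    rfl
  have hslice : SliceRegular G.T g :=
    { cont := continuousOn_const.mul ((hv.cont_z i).comp (continuous_slice i z).continuousOn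
        fun q h => ⟨h.1, mem_univ _⟩)
      diff_t := fun t ht x s => (hreg.diff_t _ (hmem t ht x _)).const_mul _
      diff_x := fun t ht x s => (hreg.diff_x _ (hmem t ht x _)).const_mul _
      diff_s := fun t ht x s => by
        have := hreg.diff_z _ (hmem t ht x (Function.update z i s))
        simp only [Function.update_idem, Function.update_self] at this
        exact this.const_mul _
      diff_xx := fun t ht x s => by
        rw [hderivx]
        exact (hreg.diff_xx _ (hmem t ht x _)).const_mul _ }
  -- `K` bounds the first-order coefficients; `K ^ 2` is for `σ² / 2`, by `(1 + |x|)² ≤ 2 (1 + x²)`.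
  have hsol : SolvesOffZeros G.T (K + K ^ 2) g := by
    intro t ht x s h0
    obtain ⟨hb, hs, hf⟩ := hK t ht x (Function.update z i s)
    have hlin := hv.linear_equation i (isOpen_Ioo.prod isOpen_univ) subset_rfl hreg
      (hmem t ht x (Function.update z i s)) (right_ne_zero_of_mul h0)
    refine ⟨_, _, 1 / 2 * G.σ t x ^ 2, hb.trans ?_, hf.trans ?_, by positivity, ?_, ?_⟩
    · gcongr
      nlinarith
    · nlinarith
    · have h1 : G.σ t x ^ 2 ≤ (K * (1 + |x|)) ^ 2 := sq_le_sq' (abs_le.1 hs).1 (abs_le.1 hs).2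
      have h2 : (1 + |x|) ^ 2 ≤ 2 * (1 + x ^ 2) := by nlinarith [sq_abs x, sq_nonneg (|x| - 1)]
      have h3 := mul_le_mul_of_nonneg_left h2 (sq_nonneg K)
      have h4 : 0 ≤ K * (1 + x ^ 2) := by positivity
      nlinarith
    · rw [hderivx]
      simp only [hg, deriv_const_mul_field]
      rw [dz_update i (dz i (v i))] at hlin
      simp only [dt, dx] at hlin ⊢
      linear_combination -G.θ i * hlin
  have hTpos : ∀ x s, 0 < g G.T x s := fun x s => hv.mul_dz_terminal_pos i x _
  have hnn : ∀ t ∈ Icc 0 G.T, ∀ x s, 0 ≤ g t x s := by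
    refine hslice.nonneg (C := |G.θ i| * (|C| * Real.exp (|c| * ‖z‖))) (c := |c|) (k := k)
      G.T_pos (by positivity) (by positivity) (abs_nonneg c) hsol hTpos ?_
    intro t ht x s
    have hz : ‖Function.update z i s‖ ≤ ‖z‖ + |s| := by
      refine (pi_norm_le_iff_of_nonneg (by positivity)).2 fun j => ?_
      by_cases h : j = i
      · subst h
        simp
      · simp only [Function.update_of_ne h]
        linarith [norm_le_pi_norm z j, abs_nonneg s]
    have h1 : c * ‖Function.update z i s‖ ≤ |c| * ‖z‖ + |c| * |s| := by
      calc _ ≤ |c| * ‖Function.update z i s‖ := by gcongr; exact le_abs_self c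
        _ ≤ |c| * (‖z‖ + |s|) := by gcongr
        _ = _ := by ring
    simp only [hg, abs_mul]
    calc |G.θ i| * |dz i (v i) t x (Function.update z i s)|
        ≤ |G.θ i| * (C * (1 + |x|) ^ k * Real.exp (c * ‖Function.update z i s‖)) := by
          gcongr
          exact hC t ht x _
      _ ≤ |G.θ i| * (|C| * (1 + |x|) ^ k * Real.exp (|c| * ‖z‖ + |c| * |s|)) := by
          gcongr
          exact le_abs_self C
      _ = _ := by rw [Real.exp_add]; ring
  have := hslice.pos (by positivity) hsol hTpos hnn t ht x (z i)
  simpa only [hg, Function.update_eq_self] using this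

end IsDualSolution

end MFTG

theorem mainTheorem6 {n d : ℕ} (G : MFTG.Game n d) (u : MFTG.Strategy n d)
    (μ : ℝ → Measure (ℝ × (Fin n → ℝ))) (v : Fin n → MFTG.Field n)
    (Hm : Fin n → ℝ → ℝ → (Fin n → ℝ) → ℝ → ℝ) (hm : Fin n → ℝ → ℝ → ℝ)
    (hv : MFTG.IsDualSolution G u μ v Hm hm)
    (η : Fin n → MFTG.Field n) (hη : ∀ i, η i = MFTG.dz i (v i)) (i : Fin n) :
    -- the linear equation, wherever the derivatives of `η i` make sense
    (∀ O : Set (ℝ × ℝ × (Fin n → ℝ)), IsOpen O → O ⊆ Ioo 0 G.T ×ˢ univ →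
      MFTG.ParabolicRegularOn i (η i) O →
      ∀ t x z, (t, x, z) ∈ O → η i t x z ≠ 0 →
        0 = MFTG.dt (η i) t x z
          + G.drift t x (μ t).fst (MFTG.profile u t x z) * MFTG.dx (η i) t x z
          + G.f i t x (μ t).fst (MFTG.profile u t x z) * MFTG.dz i (η i) t x z
          + 1 / 2 * G.σ t x ^ 2 * MFTG.dx (MFTG.dx (η i)) t x z) ∧
    -- the sign: if the dual equation makes sense everywhere, or else if everything grows moderately
    (((∀ t ∈ Icc 0 G.T, ∀ x z, η i t x z ≠ 0) ∨
      (MFTG.ParabolicRegularOn i (η i) (Ioo 0 G.T ×ˢ univ) ∧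
        MFTG.HasModerateGrowth G u μ i (η i))) →
      ∀ t ∈ Icc 0 G.T, ∀ x z, SignType.sign (η i t x z) = SignType.sign (G.θ i)) := by
  rw [hη i]
  refine ⟨fun O hO hOT hreg t x z hq h0 => hv.linear_equation i hO hOT hreg hq h0,
    fun h t ht x z => ?_⟩
  have hpos : 0 < G.θ i * MFTG.dz i (v i) t x z := by
    rcases h with h | ⟨hreg, hgr⟩
    · exact hv.mul_dz_pos_of_ne_zero i h t ht x z
    · exact hv.mul_dz_pos_of_moderateGrowth i hreg hgr t ht x z
  rcases mul_pos_iff.1 hpos with ⟨h1, h2⟩ | ⟨h1, h2⟩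
  · rw [sign_pos h1, sign_pos h2]
  · rw [sign_neg h1, sign_neg h2]
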